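/- All spaces are $T_1$; a space is paracompact if it is Hausdorff and every open cover has a locally finite open refinement. For a space $Z$, the degree of compactness $k(Z)$ is the least cardinal $m$ such that every open cover of $Z$ has an open refinement (again a cover of $Z$) of cardinality $<m$. A set-valued mapping $\theta:X\to Y$ assigns to each $x\in X$ a non-empty set $\theta(x)\subseteq Y$; its image is $\theta(X)=\bigcup_{x\in X}\theta(x)$. It is lower (upper) semi-continuous if $\{x\in X:\theta(x)\cap H\neq\emptyset\}$ is open (closed) in $X$ for every open (closed) $H\subseteq Y$. A (set-valued) selection of $\theta$ is a set-valued mapping $\phi:X\to Y$ with $\phi(x)\subseteq\theta(x)$ for all $x$; a single-valued selection is a (not necessarily continuous) function $g:X\to Y$ with $g(x)\in\theta(x)$ for all $x$. Let $X$ be a paracompact space and let $\tau$ be an infinite cardinal. Then the following properties are equivalent: - K1. $k(X)\le\tau$. - K2. For every lower semi-continuous closed-valued mapping $\theta:X\to Y$ into a complete metrizable space $Y$ there exists a lower semi-continuous selection $\phi:X\to Y$ of $\theta$ such that $k(\mathrm{cl}_Y\,\phi(X))\le\tau$. - K3. For every lower semi-continuous closed-valued mapping $\theta:X\to Y$ into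 a complete metrizable space $Y$ there exists a set-valued selection $g:X\to Y$ of $\theta$ such that $k(\mathrm{cl}_Y\,g(X))\le\tau$. - K4. For every lower semi-continuous closed-valued mapping $\theta:X\to Y$ into a complete metrizable space $Y$ there exists a single-valued selection $g:X\to Y$ of $\theta$ such that $k(\mathrm{cl}_Y\,g(X))\le\tau$. - K5. For every lower semi-continuous mapping $\theta:X\to Y$ into a discrete space $Y$ there exists a lower semi-continuous selection $\phi:X\to Y$ of $\theta$ such that $|\phi(X)|<\tau$. - K6. For every lower semi-continuous mapping $\theta:X\to Y$ into a discrete space $Y$ there exists a set-valued selection $g:X\to Y$ of $\theta$ such that $|g(X)|<\tau$. - K7. For every lower semi-continuous mapping $\theta:X\to Y$ into a discrete space $Y$ there exists a single-valued selection $g:X\to Y$ of $\theta$ such that $|g(X)|<\tau$. - K8. Every open cover of $X$ has a subcover of cardinality $<\tau$. - K9. For every lower semi-continuous closed-valued mapping $\theta:X\to Y$ into a complete metrizable space $Y$ there exist a compact-valued lower semi-continuous mapping $\varphi:X\to Y$ and a compact-valued upper semi-continuous mapping $\psi:X\to Y$ such that $k(\mathrm{cl}_Y\,\psi(X))\le\tau$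 and $\varphi(x)\subseteq\psi(x)\subseteq\theta(x)$ for every $x\in X$. - K10. For every lower semi-continuous closed-valued mapping $\theta:X\to Y$ into a complete metrizable space $Y$ there exists an upper semi-continuous selection $\phi:X\to Y$ of $\theta$ such that $k(\mathrm{cl}_Y\,\phi(X))\le\tau$. -/

import Mathlib

open Cardinal Set

universe u

/-- `γ` is a cover of the space `X` by open sets. -/
def IsOpenSetCover {X : Type u} [TopologicalSpace X] (γ : Set (Set X)) : Prop :=
  (∀ U ∈ γ, IsOpen U) ∧ ⋃₀ γ = Set.univ

/-- Every open cover of `X` has an open refinement (an open cover each of whose members is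
contained in a member of the given cover) of cardinality `< m`. -/
def HasRefinementsOfCardLT (X : Type u) [TopologicalSpace X] (m : Cardinal.{u}) : Prop :=
  ∀ γ : Set (Set X), IsOpenSetCover γ →
    ∃ δ : Set (Set X), IsOpenSetCover δ ∧ (∀ V ∈ δ, ∃ U ∈ γ, V ⊆ U) ∧ #δ < m

/-- The degree of compactness `k(X)`: the least cardinal `m` such that every open cover of `X`
has an open refinement of cardinality `< m`. -/
noncomputable def compactnessDegree (X : Type u) [TopologicalSpace X] : Cardinal.{u} :=
  sInf {m | HasRefinementsOfCardLT X m}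

/-- The infimum defining `k(X)` is attained, so it is a minimum. -/
theorem hasRefinementsOfCardLT_compactnessDegree (X : Type u) [TopologicalSpace X] :
    HasRefinementsOfCardLT X (compactnessDegree X) := by
  refine csInf_mem (s := {m | HasRefinementsOfCardLT X m})
    ⟨Order.succ #(Set X), fun γ hγ => ?_⟩
  exact ⟨γ, hγ, fun V hV => ⟨V, hV, subset_rfl⟩, Order.lt_succ_of_le (mk_set_le γ)⟩

theorem compactnessDegree_le_iff (X : Type u) [TopologicalSpace X] (m : Cardinal.{u}) :
    compactnessDegree X ≤ m ↔ HasRefinementsOfCardLT X m := by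
  refine ⟨fun h γ hγ => ?_, fun h => csInf_le' h⟩
  obtain ⟨δ, h1, h2, h3⟩ := hasRefinementsOfCardLT_compactnessDegree X γ hγ
  exact ⟨δ, h1, h2, h3.trans_le h⟩

/-- `θ` is a set-valued mapping: all its values are non-empty. -/
def IsSetValuedMap {X Y : Type u} (θ : X → Set Y) : Prop :=
  ∀ x, (θ x).Nonempty

/-- `φ` is a set-valued selection of `θ`: a mapping with non-empty values `φ x ⊆ θ x`. -/
def IsSetValuedSelection {X Y : Type u} (φ θ : X → Set Y) : Prop :=
  IsSetValuedMap φ ∧ ∀ x, φ x ⊆ θ x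

/-- `θ` is a lower semi-continuous set-valued mapping with closed values. -/
def IsLSCClosedValuedMap {X Y : Type u} [TopologicalSpace X] [TopologicalSpace Y]
    (θ : X → Set Y) : Prop :=
  IsSetValuedMap θ ∧ LowerHemicontinuous θ ∧ ∀ x, IsClosed (θ x)

/-- The image of the whole space under a set-valued mapping. -/
def setImage {X Y : Type u} (φ : X → Set Y) : Set Y :=
  ⋃ x, φ x

/-! The substance is K1 → K9. Paracompactness yields finite-valued pairs `φₙ ⊆ ψₙ`, locally constant
up to growth, respectively shrinkage, lying within `2⁻ⁿ` of `θ` and moving by at most `2⁻ⁿ` at each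
stage (`IsFiniteApproximation.exists_refinement`). Their Hausdorff limits are compact by
completeness, keep both kinds of semi-continuity, and lie in `θ` because its values are closed. An
upper semi-continuous compact-valued `ψ` then transports `k ≤ τ` from `X` to the closure of its
image: each `ψ x` needs finitely many members of a cover, and so do nearby values. For the way back,
a subset of a discrete space whose closure has `k ≤ τ` has fewer than `τ` points, and an open cover,
viewed as a discrete space, turns selections into subcovers. -/

open Filter Topology TopologicalSpace ENNReal

/-! ### Finite-valued approximations -/

/-- A pair of finite-valued maps `φ ⊆ ψ` whose values are, up to `ε`, in those of `θ`, and which are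
lower respectively upper semi-continuous for the discrete topology of the target. -/
structure IsFiniteApproximation {X Y : Type*} [TopologicalSpace X] [PseudoEMetricSpace Y]
    (θ : X → Set Y) (ε : ℝ≥0∞) (φ ψ : X → Set Y) : Prop where
  nonempty : ∀ x, (φ x).Nonempty
  subset : ∀ x, φ x ⊆ ψ x
  finite : ∀ x, (ψ x).Finite
  lower : ∀ x, ∀ᶠ x' in 𝓝 x, φ x ⊆ φ x'
  upper : ∀ x, ∀ᶠ x' in 𝓝 x, ψ x' ⊆ ψ x
  near : ∀ x, ∀ y ∈ ψ x, ∃ z ∈ θ x, edist y z < ε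

theorem hausdorffEDist_le_of_forall_refinement {ι Y : Type*} [PseudoEMetricSpace Y] {s : Set ι}
    {A : Set Y} {z : ι → Y → Y} {ε : ℝ≥0∞} (hs : s.Nonempty)
    (h : ∀ i ∈ s, ∀ y ∈ A, edist y (z i y) ≤ ε) :
    Metric.hausdorffEDist A (⋃ i ∈ s, z i '' A) ≤ ε := by
  obtain ⟨i, hi⟩ := hs
  refine Metric.hausdorffEDist_le_of_mem_edist (fun y hy => ?_) fun y hy => ?_
  · exact ⟨z i y, mem_biUnion hi (mem_image_of_mem _ hy), h i hi y hy⟩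
  · simp only [mem_iUnion, mem_image] at hy
    obtain ⟨j, hj, a, ha, rfl⟩ := hy
    exact ⟨a, ha, by rw [edist_comm]; exact h j hj a ha⟩

/-- Move each `y ∈ ψ x` to a point `z x y ∈ θ x`; by finiteness and lower semi-continuity these
points stay `δ`-close to `θ x'` for `x'` near `x`. A locally finite cover glues the moves. -/
theorem IsFiniteApproximation.exists_refinement {X Y : Type*} [TopologicalSpace X] [T2Space X]
    [ParacompactSpace X] [PseudoEMetricSpace Y] {θ : X → Set Y} (hθ : LowerHemicontinuous θ)
    {ε δ : ℝ≥0∞} (hδ : 0 < δ) {φ ψ : X → Set Y} (h : IsFiniteApproximation θ ε φ ψ) :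
    ∃ φ' ψ' : X → Set Y, IsFiniteApproximation θ δ φ' ψ' ∧
      (∀ x, Metric.hausdorffEDist (φ x) (φ' x) ≤ ε) ∧
      ∀ x, Metric.hausdorffEDist (ψ x) (ψ' x) ≤ ε := by
  classical
  have hz : ∀ x y, ∃ z, y ∈ ψ x → z ∈ θ x ∧ edist y z < ε := fun x y => by
    by_cases hy : y ∈ ψ x
    · obtain ⟨z, hz, hyz⟩ := h.near x y hy
      exact ⟨z, fun _ => ⟨hz, hyz⟩⟩
    · exact ⟨y, fun h => (hy h).elim⟩
  choose z hz using hz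
  let good (x : X) : Set X := {x' | ψ x' ⊆ ψ x ∧ ∀ y ∈ ψ x, ∃ w ∈ θ x', edist (z x y) w < δ}
  have hgood : ∀ x, good x ∈ 𝓝 x := fun x => by
    refine (h.upper x).and ((Filter.eventually_all_finite (h.finite x)).2 fun y hy => ?_)
    have hx : x ∈ {x' | (θ x' ∩ Metric.eball (z x y) δ).Nonempty} :=
      ⟨z x y, (hz x y hy).1, Metric.mem_eball_self hδ⟩
    filter_upwards [(lowerHemicontinuous_iff_isOpen_inter_nonempty.1 hθ _
      Metric.isOpen_eball).mem_nhds hx] with x' hx'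
    obtain ⟨w, hw, hwδ⟩ := hx'
    exact ⟨w, hw, by rw [edist_comm]; exact hwδ⟩
  obtain ⟨u, huo, huU, hulf, hug⟩ := precise_refinement (fun x => interior (good x))
    (fun _ => isOpen_interior)
    (iUnion_eq_univ_iff.2 fun x => ⟨x, mem_interior_iff_mem_nhds.2 (hgood x)⟩)
  obtain ⟨v, hvU, hvo, hvu⟩ := exists_iUnion_eq_closure_subset huo hulf.point_finite huU
  have hvlf : LocallyFinite fun i => closure (v i) := hulf.subset hvu
  have hvg : ∀ i, closure (v i) ⊆ good i := fun i =>
    (hvu i).trans ((hug i).trans interior_subset)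
  have hsub : ∀ x, {i | x ∈ v i} ⊆ {i | x ∈ closure (v i)} := fun x i hi => subset_closure hi
  have hne : ∀ x, {i | x ∈ v i}.Nonempty := fun x => iUnion_eq_univ_iff.1 hvU x
  have hdist : ∀ x, ∀ i ∈ {i | x ∈ closure (v i)}, ∀ y ∈ ψ x, edist y (z i y) ≤ ε :=
    fun x i hi y hy => (hz i y ((hvg i hi).1 hy)).2.le
  -- Near a point, the set of indices can only grow for the open sets `v i`, and only shrink for
  -- their locally finite closures: hence the lower and the upper condition.
  refine ⟨fun x => ⋃ i ∈ {i | x ∈ v i}, z i '' φ x,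
    fun x => ⋃ i ∈ {i | x ∈ closure (v i)}, z i '' ψ x, ⟨fun x => ?_, fun x => ?_, fun x => ?_,
      fun x => ?_, fun x => ?_, fun x y hy => ?_⟩, fun x => ?_, fun x => ?_⟩
  · obtain ⟨i, hi⟩ := hne x
    obtain ⟨y, hy⟩ := h.nonempty x
    exact ⟨z i y, mem_biUnion hi (mem_image_of_mem _ hy)⟩
  · exact biUnion_mono (hsub x) fun i _ => image_mono (h.subset x)
  · exact (hvlf.point_finite x).biUnion fun i _ => (h.finite x).image _
  · have hfin : {i | x ∈ v i}.Finite := (hvlf.point_finite x).subset (hsub x)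
    filter_upwards [h.lower x, (Filter.eventually_all_finite hfin).2
      fun i hi => (hvo i).mem_nhds hi] with x' h1 h2
    exact biUnion_mono (fun i hi => h2 i hi) fun i _ => image_mono h1
  · filter_upwards [h.upper x, hvlf.eventually_subset (fun _ => isClosed_closure) x] with x' h1 h2
    exact biUnion_mono h2 fun i _ => image_mono h1
  · simp only [mem_iUnion, mem_image] at hy
    obtain ⟨i, hi, a, ha, rfl⟩ := hy
    exact (hvg i hi).2 a ((hvg i hi).1 ha)
  · exact hausdorffEDist_le_of_forall_refinement (hne x)
      fun i hi y hy => hdist x i (hsub x hi) y (h.subset x hy)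
  · exact hausdorffEDist_le_of_forall_refinement ((hne x).mono (hsub x)) (hdist x)

theorem exists_isFiniteApproximation {X Y : Type*} [TopologicalSpace X] [T2Space X]
    [ParacompactSpace X] [PseudoMetricSpace Y] {θ : X → Set Y} (hne : ∀ x, (θ x).Nonempty)
    (hθ : LowerHemicontinuous θ) {δ : ℝ≥0∞} (hδ : 0 < δ) :
    ∃ φ ψ : X → Set Y, IsFiniteApproximation θ δ φ ψ := by
  rcases isEmpty_or_nonempty X with hX | ⟨⟨x₀⟩⟩
  · exact ⟨θ, θ, by constructor <;> exact fun x => hX.elim x⟩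
  obtain ⟨y₀, -⟩ := hne x₀
  -- With error `⊤` any constant singleton qualifies, since distances are finite.
  have h : IsFiniteApproximation θ ⊤ (fun _ => {y₀}) fun _ => {y₀} :=
    ⟨by simp, by simp, by simp, by simp, by simp, fun x y _ =>
      (hne x).imp fun z hz => ⟨hz, edist_lt_top _ _⟩⟩
  obtain ⟨φ, ψ, h', -⟩ := h.exists_refinement hθ hδ
  exact ⟨φ, ψ, h'⟩

theorem exists_seq_isFiniteApproximation {X Y : Type*} [TopologicalSpace X] [T2Space X]
    [ParacompactSpace X] [PseudoMetricSpace Y] {θ : X → Set Y} (hne : ∀ x, (θ x).Nonempty)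
    (hθ : LowerHemicontinuous θ) :
    ∃ φ ψ : ℕ → X → Set Y, (∀ n, IsFiniteApproximation θ (1 / 2 ^ n) (φ n) (ψ n)) ∧
      (∀ n x, Metric.hausdorffEDist (φ n x) (φ (n + 1) x) ≤ 1 / 2 ^ n) ∧
      ∀ n x, Metric.hausdorffEDist (ψ n x) (ψ (n + 1) x) ≤ 1 / 2 ^ n := by
  have hpos : ∀ n : ℕ, (0 : ℝ≥0∞) < 1 / 2 ^ n := fun n =>
    ENNReal.div_pos one_ne_zero (by finiteness)
  obtain ⟨φ₀, ψ₀, h₀⟩ := exists_isFiniteApproximation hne hθ (hpos 0)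
  let P (n : ℕ) (p : (X → Set Y) × (X → Set Y)) : Prop :=
    IsFiniteApproximation θ (1 / 2 ^ n) p.1 p.2
  have hstep : ∀ n (p : Subtype (P n)), ∃ q : Subtype (P (n + 1)),
      (∀ x, Metric.hausdorffEDist (p.1.1 x) (q.1.1 x) ≤ 1 / 2 ^ n) ∧
        ∀ x, Metric.hausdorffEDist (p.1.2 x) (q.1.2 x) ≤ 1 / 2 ^ n := fun n p => by
    obtain ⟨φ, ψ, h1, h2⟩ := p.2.exists_refinement hθ (hpos (n + 1))
    exact ⟨⟨(φ, ψ), h1⟩, h2⟩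
  choose step hstep using hstep
  let f : ∀ n, Subtype (P n) := fun n => Nat.rec ⟨(φ₀, ψ₀), h₀⟩ step n
  exact ⟨fun n => (f n).1.1, fun n => (f n).1.2, fun n => (f n).2, fun n => (hstep n (f n)).1,
    fun n => (hstep n (f n)).2⟩

/-! ### Hausdorff limits -/

/-- The nonempty compact subsets of a complete space are complete for the Hausdorff distance; the
bound is the tail of a geometric series. -/
theorem exists_isCompact_hausdorffEDist_le {Y : Type*} [EMetricSpace Y] [CompleteSpace Y]
    {s : ℕ → Set Y} (hne : ∀ n, (s n).Nonempty) (hc : ∀ n, IsCompact (s n))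
    (hd : ∀ n, Metric.hausdorffEDist (s n) (s (n + 1)) ≤ 1 / 2 ^ n) :
    ∃ t : Set Y, t.Nonempty ∧ IsCompact t ∧
      ∀ n, Metric.hausdorffEDist (s n) t ≤ 2 * 1 / 2 ^ n := by
  let f (n : ℕ) : NonemptyCompacts Y := ⟨⟨s n, hc n⟩, hne n⟩
  have hf : ∀ n, edist (f n) (f (n + 1)) ≤ 1 / 2 ^ n := hd
  obtain ⟨t, ht⟩ := cauchySeq_tendsto_of_complete
    (cauchySeq_of_edist_le_geometric_two 1 one_ne_top hf)
  exact ⟨t, t.nonempty, t.isCompact, edist_le_of_edist_le_geometric_two_of_tendsto 1 hf ht⟩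

section HausdorffLimit

variable {X Y : Type*} [TopologicalSpace X] [PseudoEMetricSpace Y] {d : ℕ → ℝ≥0∞}
  {F : ℕ → X → Set Y} {G : X → Set Y}

theorem LowerHemicontinuous.of_hausdorffEDist_le (hd : Tendsto d atTop (𝓝 0))
    (hF : ∀ n x, Metric.hausdorffEDist (F n x) (G x) ≤ d n)
    (hlow : ∀ n x, ∀ᶠ x' in 𝓝 x, F n x ⊆ F n x') : LowerHemicontinuous G := by
  rw [lowerHemicontinuous_iff_isOpen_inter_nonempty]
  refine fun U hU => isOpen_iff_mem_nhds.2 fun x hx => ?_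
  obtain ⟨y, hy, hyU⟩ := hx
  obtain ⟨ε, hε, hεU⟩ := EMetric.isOpen_iff.1 hU y hyU
  obtain ⟨n, hn⟩ := (hd.eventually_lt_const (ENNReal.half_pos hε.ne')).exists
  obtain ⟨z, hz, hyz⟩ := Metric.exists_edist_lt_of_hausdorffEDist_lt hy
    ((Metric.hausdorffEDist_comm.trans_le (hF n x)).trans_lt hn)
  filter_upwards [hlow n x] with x' hx'
  obtain ⟨w, hw, hzw⟩ := Metric.exists_edist_lt_of_hausdorffEDist_lt (hx' hz)
    ((hF n x').trans_lt hn)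
  refine ⟨w, hw, hεU ?_⟩
  rw [Metric.mem_eball, edist_comm, ← ENNReal.add_halves ε]
  exact (edist_triangle y z w).trans_lt (ENNReal.add_lt_add hyz hzw)

theorem UpperHemicontinuous.of_hausdorffEDist_le (hd : Tendsto d atTop (𝓝 0))
    (hF : ∀ n x, Metric.hausdorffEDist (F n x) (G x) ≤ d n) (hG : ∀ x, IsCompact (G x))
    (hup : ∀ n x, ∀ᶠ x' in 𝓝 x, F n x' ⊆ F n x) : UpperHemicontinuous G := by
  rw [upperHemicontinuous_iff_forall_isOpen]
  intro x U hU hxU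
  -- Compactness gives room of uniform size around the whole value `G x`.
  obtain ⟨δ, hδ, hδU⟩ := (hG x).exists_thickening_subset_open hU hxU
  have hδ' : (0 : ℝ≥0∞) < ENNReal.ofReal δ := ENNReal.ofReal_pos.2 hδ
  obtain ⟨n, hn⟩ := (hd.eventually_lt_const (ENNReal.half_pos hδ'.ne')).exists
  filter_upwards [hup n x] with x' hx' y hy
  obtain ⟨z, hz, hyz⟩ := Metric.exists_edist_lt_of_hausdorffEDist_lt hy
    ((Metric.hausdorffEDist_comm.trans_le (hF n x')).trans_lt hn)
  obtain ⟨w, hw, hzw⟩ := Metric.exists_edist_lt_of_hausdorffEDist_lt (hx' hz)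
    ((hF n x).trans_lt hn)
  refine hδU ((Metric.mem_thickening_iff_exists_edist_lt _ _).2 ⟨w, hw, ?_⟩)
  rw [← ENNReal.add_halves (ENNReal.ofReal δ)]
  exact (edist_triangle y z w).trans_lt (ENNReal.add_lt_add hyz hzw)

theorem subset_of_hausdorffEDist_le {Fx : ℕ → Set Y} {Gx T : Set Y} (hT : IsClosed T)
    (hd : Tendsto d atTop (𝓝 0)) (hF : ∀ n, Metric.hausdorffEDist (Fx n) Gx ≤ d n)
    (hFT : ∀ n, ∀ y ∈ Fx n, Metric.infEDist y T ≤ d n) : Gx ⊆ T := by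
  intro y hy
  rw [Metric.mem_iff_infEDist_zero_of_closed hT, ← nonpos_iff_eq_zero]
  refine ENNReal.le_of_forall_pos_le_add fun ε hε _ => ?_
  have hε' : (0 : ℝ≥0∞) < ε := by exact_mod_cast hε
  obtain ⟨n, hn⟩ := (hd.eventually_lt_const (ENNReal.half_pos hε'.ne')).exists
  obtain ⟨z, hz, hyz⟩ := Metric.exists_edist_lt_of_hausdorffEDist_lt hy
    ((Metric.hausdorffEDist_comm.trans_le (hF n)).trans_lt hn)
  calc Metric.infEDist y T ≤ Metric.infEDist z T + edist y z :=
        Metric.infEDist_le_infEDist_add_edist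
    _ ≤ ε / 2 + ε / 2 := add_le_add ((hFT n z hz).trans hn.le) hyz.le
    _ = 0 + ε := by rw [ENNReal.add_halves, zero_add]

end HausdorffLimit

/-- Michael's selection theorem for set-valued selections. -/
theorem exists_compact_lower_upper_selection {X Y : Type u} [TopologicalSpace X] [T2Space X]
    [ParacompactSpace X] [TopologicalSpace Y] [IsCompletelyMetrizableSpace Y] {θ : X → Set Y}
    (hθ : IsLSCClosedValuedMap θ) :
    ∃ φ ψ : X → Set Y, IsSetValuedSelection φ ψ ∧ IsSetValuedSelection ψ θ ∧
      LowerHemicontinuous φ ∧ (∀ x, IsCompact (φ x)) ∧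
      UpperHemicontinuous ψ ∧ (∀ x, IsCompact (ψ x)) := by
  let _ := upgradeIsCompletelyMetrizable Y
  obtain ⟨hne, hlow, hclosed⟩ := hθ
  obtain ⟨φ, ψ, h, hφ, hψ⟩ := exists_seq_isFiniteApproximation hne hlow
  choose φ' hφne hφc hφd using fun x => exists_isCompact_hausdorffEDist_le (s := fun n => φ n x)
    (fun n => (h n).nonempty x) (fun n => (((h n).finite x).subset ((h n).subset x)).isCompact)
    fun n => hφ n x
  choose ψ' hψne hψc hψd using fun x => exists_isCompact_hausdorffEDist_le (s := fun n => ψ n x)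
    (fun n => ((h n).nonempty x).mono ((h n).subset x)) (fun n => ((h n).finite x).isCompact)
    fun n => hψ n x
  have hd : Tendsto (fun n : ℕ => (2 * 1 / 2 ^ n : ℝ≥0∞)) atTop (𝓝 0) := by
    simpa [div_eq_mul_inv, ENNReal.inv_pow] using ENNReal.Tendsto.const_mul (a := 2 * 1)
      (ENNReal.tendsto_pow_atTop_nhds_zero_of_lt_one (r := 2⁻¹) (by simp)) (Or.inr (by simp))
  refine ⟨φ', ψ', ⟨hφne, fun x => ?_⟩, ⟨hψne, fun x => ?_⟩,
    .of_hausdorffEDist_le hd (fun n x => hφd x n) fun n => (h n).lower, hφc,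
    .of_hausdorffEDist_le hd (fun n x => hψd x n) hψc fun n => (h n).upper, hψc⟩
  · refine subset_of_hausdorffEDist_le (hψc x).isClosed hd (hφd x) fun n y hy => ?_
    exact (Metric.infEDist_le_hausdorffEDist_of_mem ((h n).subset x hy)).trans (hψd x n)
  · refine subset_of_hausdorffEDist_le (hclosed x) hd (hψd x) fun n y hy => ?_
    obtain ⟨z, hz, hyz⟩ := (h n).near x y hy
    refine (Metric.infEDist_le_edist_of_mem hz).trans (hyz.le.trans ?_)
    gcongr
    norm_num

/-! ### Degree of compactness -/

/-- Regularity of `τ` is not needed: finitely many finite sets have a finite union, and for infinite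
`δ` one has `#δ * ℵ₀ = #δ`. -/
theorem mk_biUnion_finset_lt {ι α : Type u} (F : ι → Finset α) {τ : Cardinal.{u}} (hτ : ℵ₀ ≤ τ)
    {δ : Set ι} (hδ : #δ < τ) : #(⋃ i ∈ δ, (F i : Set α) : Set α) < τ := by
  rcases lt_or_ge #δ ℵ₀ with hfin | hinf
  · have : (⋃ i ∈ δ, (F i : Set α)).Finite :=
      (Cardinal.lt_aleph0_iff_set_finite.1 hfin).biUnion fun i _ => (F i).finite_toSet
    exact this.lt_aleph0.trans_le hτ
  · refine lt_of_le_of_lt ?_ hδ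
    refine (Cardinal.mk_biUnion_le _ _).trans ?_
    calc #δ * ⨆ i : δ, #(F i : Set α) ≤ #δ * ℵ₀ := by
          gcongr
          exact ciSup_le' fun i => (F i).finite_toSet.lt_aleph0.le
      _ = #δ := Cardinal.mul_aleph0_eq hinf

/-- The closure of the image of `X` under a compact-valued upper semi-continuous map into a
metrizable space has degree of compactness at most `τ` if `X` has, for every infinite `τ`. -/
theorem compactnessDegree_closure_setImage_le {X Y : Type u} [TopologicalSpace X]
    [TopologicalSpace Y] [MetrizableSpace Y] {τ : Cardinal.{u}} (hτ : ℵ₀ ≤ τ)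
    (hX : compactnessDegree X ≤ τ) {ψ : X → Set Y} (hψ : UpperHemicontinuous ψ)
    (hc : ∀ x, IsCompact (ψ x)) : compactnessDegree (closure (setImage ψ)) ≤ τ := by
  classical
  rw [compactnessDegree_le_iff] at hX ⊢
  let _ := metrizableSpaceMetric Y
  intro γ hγ
  let T : Set Y := closure (setImage ψ)
  let ψT (x : X) : Set T := Subtype.val ⁻¹' ψ x
  have hT : IsClosed (range (Subtype.val : T → Y)) := by
    rw [Subtype.range_coe]; exact isClosed_closure
  have hψT : UpperHemicontinuous ψT :=
    (upperHemicontinuous_iff.2 fun x => upperHemicontinuousWithinAt_univ_iff.1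
      ((hψ.upperHemicontinuousWithinAt Set.univ x).isInducing_comp Topology.IsInducing.subtypeVal hT))
  have hcT : ∀ x, IsCompact (ψT x) := fun x =>
    (isClosed_closure.isClosedEmbedding_subtypeVal).isCompact_preimage (hc x)
  have hdense : closure (⋃ x, ψT x) = Set.univ := by
    refine eq_univ_of_forall fun y => ?_
    rw [closure_subtype]
    convert y.2 using 1
    congr 1
    ext z
    simp only [ψT, mem_image, mem_iUnion, mem_preimage, setImage]
    constructor
    · rintro ⟨w, ⟨x, hx⟩, rfl⟩
      exact ⟨x, hx⟩
    · rintro ⟨x, hx⟩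
      exact ⟨⟨z, subset_closure (mem_iUnion.2 ⟨x, hx⟩)⟩, ⟨x, hx⟩, rfl⟩
  obtain ⟨v, hvo, hvU, hvlf, hvγ⟩ := precise_refinement (fun U : γ => U.1) (fun U => hγ.1 U U.2)
    (by rw [← sUnion_eq_iUnion]; exact hγ.2)
  obtain ⟨w, hwU, hwo, hwv⟩ := exists_iUnion_eq_closure_subset hvo hvlf.point_finite hvU
  choose F hF using fun x => (hcT x).elim_finite_subcover w hwo (hwU ▸ Set.subset_univ _)
  -- By upper semi-continuity these sets are open; a small refinement of this cover selects few
  -- finite subfamilies.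
  let O (x : X) : Set X := ψT ⁻¹' Iic (⋃ i ∈ F x, w i)
  obtain ⟨δ, hδ, hδO, hδτ⟩ := hX (range O) ⟨forall_mem_range.2 fun x =>
    upperHemicontinuous_iff_isOpen_preimage_Iic.1 hψT _
      (isOpen_biUnion fun i _ => hwo i),
    sUnion_eq_univ_iff.2 fun x => ⟨_, mem_range_self x, hF x⟩⟩
  have hδF : ∀ V, ∃ S : Finset γ, V ∈ δ → ∀ x ∈ V, ψT x ⊆ ⋃ i ∈ S, w i := fun V => by
    by_cases hV : V ∈ δ
    · obtain ⟨-, ⟨x, rfl⟩, hx⟩ := hδO V hV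
      exact ⟨F x, fun _ => hx⟩
    · exact ⟨∅, fun h => (hV h).elim⟩
  choose S hS using hδF
  let s : Set γ := ⋃ V ∈ δ, (S V : Set γ)
  have hs : #s < τ := mk_biUnion_finset_lt S hτ hδτ
  -- The selected `w i` cover only the dense image; by local finiteness the union of their closures
  -- is closed, hence everything.
  have hcov : ⋃ i ∈ s, closure (w i) = Set.univ := by
    have hcl : IsClosed (⋃ i ∈ s, closure (w i)) := by
      rw [biUnion_eq_iUnion]
      exact ((hvlf.subset fun i => subset_closure.trans (hwv i)).closure.comp_injective
        Subtype.val_injective).isClosed_iUnion fun _ => isClosed_closure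
    rw [← Set.univ_subset_iff, ← hdense]
    refine closure_minimal (iUnion_subset fun x y hy => ?_) hcl
    obtain ⟨V, hV, hx⟩ := sUnion_eq_univ_iff.1 hδ.2 x
    obtain ⟨i, hi, hyi⟩ := mem_iUnion₂.1 (hS V hV x hx hy)
    exact mem_biUnion (mem_biUnion hV hi) (subset_closure hyi)
  refine ⟨Subtype.val '' s, ⟨?_, ?_⟩, ?_, Cardinal.mk_image_le.trans_lt hs⟩
  · rintro _ ⟨U, -, rfl⟩
    exact hγ.1 U U.2
  · refine sUnion_eq_univ_iff.2 fun y => ?_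
    obtain ⟨i, hi, hyi⟩ := mem_iUnion₂.1 (hcov.ge (Set.mem_univ y))
    exact ⟨i, mem_image_of_mem _ hi, hvγ i (hwv i hyi)⟩
  · rintro _ ⟨U, -, rfl⟩
    exact ⟨U, U.2, subset_rfl⟩

theorem compactnessDegree_mono {Y : Type u} [TopologicalSpace Y] {A B : Set Y} (hA : IsClosed A)
    (hAB : A ⊆ B) {τ : Cardinal.{u}} (hB : compactnessDegree B ≤ τ) : compactnessDegree A ≤ τ := by
  rw [compactnessDegree_le_iff] at hB ⊢
  intro γ hγ
  let C : Set B := Subtype.val ⁻¹' A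
  have hC : IsClosed C := hA.preimage continuous_subtype_val
  -- Inserting `∅` admits the complement of `A`, whose trace is empty. Empty traces are deleted
  -- later, as `γ` may have no member to contain them.
  let γ' : Set (Set B) := {V | IsOpen V ∧ ∃ U ∈ insert ∅ γ, inclusion hAB ⁻¹' V ⊆ U}
  have hγ' : IsOpenSetCover γ' := by
    refine ⟨fun V hV => hV.1, sUnion_eq_univ_iff.2 fun b => ?_⟩
    by_cases hb : (b : Y) ∈ A
    · obtain ⟨U, hU, hbU⟩ := sUnion_eq_univ_iff.1 hγ.2 ⟨b, hb⟩
      obtain ⟨W, hW, rfl⟩ := isOpen_induced_iff.1 (hγ.1 U hU)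
      exact ⟨Subtype.val ⁻¹' W, ⟨hW.preimage continuous_subtype_val, _, Or.inr hU, subset_rfl⟩, hbU⟩
    · refine ⟨Cᶜ, ⟨hC.isOpen_compl, ∅, Or.inl rfl, fun a ha => ha a.2⟩, hb⟩
  obtain ⟨δ, hδ, hδγ, hδτ⟩ := hB γ' hγ'
  have hsub : (preimage (inclusion hAB) '' δ) \ {∅} ⊆ preimage (inclusion hAB) '' δ :=
    sdiff_subset
  refine ⟨(preimage (inclusion hAB) '' δ) \ {∅}, ⟨?_, ?_⟩, ?_,
    (Cardinal.mk_le_mk_of_subset hsub).trans_lt (Cardinal.mk_image_le.trans_lt hδτ)⟩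
  · rintro _ ⟨⟨V, hV, rfl⟩, -⟩
    exact (hδ.1 V hV).preimage (continuous_inclusion hAB)
  · refine sUnion_eq_univ_iff.2 fun a => ?_
    obtain ⟨V, hV, haV⟩ := sUnion_eq_univ_iff.1 hδ.2 (inclusion hAB a)
    exact ⟨_, ⟨mem_image_of_mem _ hV, Nonempty.ne_empty ⟨a, haV⟩⟩, haV⟩
  · rintro _ ⟨⟨V, hV, rfl⟩, hne⟩
    obtain ⟨V', ⟨-, U, hU, hV'U⟩, hVV'⟩ := hδγ V hV
    have hVU := (preimage_mono hVV').trans hV'U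
    rcases hU with rfl | hU
    · exact (hne (subset_empty_iff.1 hVU)).elim
    · exact ⟨U, hU, hVU⟩

/-- Members of a refinement of the cover by singletons have at most one point, so choosing a member
around each point is injective. -/
theorem mk_lt_of_compactnessDegree_closure_le {Y : Type u} [TopologicalSpace Y]
    [DiscreteTopology Y] {A : Set Y} {τ : Cardinal.{u}}
    (h : compactnessDegree (closure A) ≤ τ) : #A < τ := by
  rw [compactnessDegree_le_iff] at h
  obtain ⟨δ, hδ, hδγ, hδτ⟩ := h (range fun a => {a})
    ⟨fun _ _ => isOpen_discrete _, sUnion_eq_univ_iff.2 fun a => ⟨_, mem_range_self a, rfl⟩⟩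
  choose V hVδ hV using sUnion_eq_univ_iff.1 hδ.2
  have hinj : Function.Injective fun a => (⟨V a, hVδ a⟩ : δ) := fun a b hab => by
    have hab : V a = V b := congrArg Subtype.val hab
    obtain ⟨-, ⟨c, rfl⟩, hc⟩ := hδγ (V a) (hVδ a)
    have h1 : a = c := hc (hV a)
    have h2 : b = c := hc (hab ▸ hV b)
    exact h1.trans h2.symm
  exact (Cardinal.mk_le_mk_of_subset subset_closure).trans_lt
    ((Cardinal.mk_le_of_injective hinj).trans_lt hδτ)

/-! ### Subcovers from selections and the equivalences -/

theorem setImage_singleton {X Y : Type u} (g : X → Y) :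
    setImage (fun x => ({g x} : Set Y)) = range g :=
  iUnion_singleton_eq_range g

/-- The members of an open cover containing a given point form a lower semi-continuous map into the
cover with its discrete topology; a selection with small range yields a small subcover. -/
theorem exists_subcover_of_exists_selection {X : Type u} [TopologicalSpace X]
    {τ : Cardinal.{u}} {γ : Set (Set X)} (hγ : IsOpenSetCover γ)
    (h : ∀ [TopologicalSpace γ] [DiscreteTopology γ] (θ : X → Set γ), IsSetValuedMap θ →
      LowerHemicontinuous θ → ∃ g : X → γ, (∀ x, g x ∈ θ x) ∧ #(range g) < τ) :
    ∃ δ ⊆ γ, IsOpenSetCover δ ∧ #δ < τ := by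
  let _ : TopologicalSpace γ := ⊥
  have : DiscreteTopology γ := ⟨rfl⟩
  obtain ⟨g, hg, hgτ⟩ := h (fun x => {U | x ∈ U.1})
    (fun x => by
      obtain ⟨U, hU, hx⟩ := sUnion_eq_univ_iff.1 hγ.2 x
      exact ⟨⟨U, hU⟩, hx⟩)
    (lowerHemicontinuous_iff_isOpen_inter_nonempty.2 fun s _ =>
      isOpen_iff_mem_nhds.2 fun x ⟨U, hxU, hUs⟩ =>
        mem_of_superset ((hγ.1 U U.2).mem_nhds hxU) fun x' hx' => ⟨U, hx', hUs⟩)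
  refine ⟨Subtype.val '' range g, Subtype.coe_image_subset _ _, ⟨?_, ?_⟩,
    Cardinal.mk_image_le.trans_lt hgτ⟩
  · rintro _ ⟨U, -, rfl⟩
    exact hγ.1 U U.2
  · exact sUnion_eq_univ_iff.2 fun x => ⟨g x, mem_image_of_mem _ (mem_range_self x), hg x⟩

theorem corollary2p9 (X : Type u) [TopologicalSpace X] [T2Space X] [ParacompactSpace X]
    (τ : Cardinal.{u}) (hτ : ℵ₀ ≤ τ) :
    List.TFAE [
      -- K1
      compactnessDegree X ≤ τ,
      -- K2
      ∀ (Y : Type u) [TopologicalSpace Y] [TopologicalSpace.IsCompletelyMetrizableSpace Y]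
        (θ : X → Set Y), IsLSCClosedValuedMap θ →
        ∃ φ : X → Set Y, IsSetValuedSelection φ θ ∧ LowerHemicontinuous φ ∧
          compactnessDegree (closure (setImage φ)) ≤ τ,
      -- K3
      ∀ (Y : Type u) [TopologicalSpace Y] [TopologicalSpace.IsCompletelyMetrizableSpace Y]
        (θ : X → Set Y), IsLSCClosedValuedMap θ →
        ∃ g : X → Set Y, IsSetValuedSelection g θ ∧
          compactnessDegree (closure (setImage g)) ≤ τ,
      -- K4
      ∀ (Y : Type u) [TopologicalSpace Y] [TopologicalSpace.IsCompletelyMetrizableSpace Y]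
        (θ : X → Set Y), IsLSCClosedValuedMap θ →
        ∃ g : X → Y, (∀ x, g x ∈ θ x) ∧ compactnessDegree (closure (range g)) ≤ τ,
      -- K5
      ∀ (Y : Type u) [TopologicalSpace Y] [DiscreteTopology Y]
        (θ : X → Set Y), IsSetValuedMap θ → LowerHemicontinuous θ →
        ∃ φ : X → Set Y, IsSetValuedSelection φ θ ∧ LowerHemicontinuous φ ∧
          #(setImage φ) < τ,
      -- K6
      ∀ (Y : Type u) [TopologicalSpace Y] [DiscreteTopology Y]
        (θ : X → Set Y), IsSetValuedMap θ → LowerHemicontinuous θ →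
        ∃ g : X → Set Y, IsSetValuedSelection g θ ∧ #(setImage g) < τ,
      -- K7
      ∀ (Y : Type u) [TopologicalSpace Y] [DiscreteTopology Y]
        (θ : X → Set Y), IsSetValuedMap θ → LowerHemicontinuous θ →
        ∃ g : X → Y, (∀ x, g x ∈ θ x) ∧ #(range g) < τ,
      -- K8
      ∀ γ : Set (Set X), IsOpenSetCover γ →
        ∃ δ ⊆ γ, IsOpenSetCover δ ∧ #δ < τ,
      -- K9
      ∀ (Y : Type u) [TopologicalSpace Y] [TopologicalSpace.IsCompletelyMetrizableSpace Y]
        (θ : X → Set Y), IsLSCClosedValuedMap θ →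
        ∃ φ ψ : X → Set Y, IsSetValuedSelection φ ψ ∧ IsSetValuedSelection ψ θ ∧
          LowerHemicontinuous φ ∧ (∀ x, IsCompact (φ x)) ∧
          UpperHemicontinuous ψ ∧ (∀ x, IsCompact (ψ x)) ∧
          compactnessDegree (closure (setImage ψ)) ≤ τ,
      -- K10
      ∀ (Y : Type u) [TopologicalSpace Y] [TopologicalSpace.IsCompletelyMetrizableSpace Y]
        (θ : X → Set Y), IsLSCClosedValuedMap θ →
        ∃ φ : X → Set Y, IsSetValuedSelection φ θ ∧ UpperHemicontinuous φ ∧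
          compactnessDegree (closure (setImage φ)) ≤ τ] := by
  have mono : ∀ {Y : Type u} [TopologicalSpace Y] {φ ψ : X → Set Y}, (∀ x, φ x ⊆ ψ x) →
      compactnessDegree (closure (setImage ψ)) ≤ τ →
      compactnessDegree (closure (setImage φ)) ≤ τ := fun h hψ =>
    compactnessDegree_mono isClosed_closure (closure_mono (iUnion_mono h)) hψ
  tfae_have 1 → 9 := fun hX Y _ _ θ hθ => by
    obtain ⟨φ, ψ, h1, h2, h3, h4, h5, h6⟩ := exists_compact_lower_upper_selection hθ
    exact ⟨φ, ψ, h1, h2, h3, h4, h5, h6, compactnessDegree_closure_setImage_le hτ hX h5 h6⟩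
  tfae_have 9 → 10 := fun h Y _ _ θ hθ => by
    obtain ⟨φ, ψ, h1, h2, h3, h4, h5, h6, h7⟩ := h Y θ hθ
    exact ⟨ψ, h2, h5, h7⟩
  tfae_have 10 → 3 := fun h Y _ _ θ hθ => by
    obtain ⟨φ, h1, h2, h3⟩ := h Y θ hθ
    exact ⟨φ, h1, h3⟩
  tfae_have 9 → 2 := fun h Y _ _ θ hθ => by
    obtain ⟨φ, ψ, h1, h2, h3, h4, h5, h6, h7⟩ := h Y θ hθ
    exact ⟨φ, ⟨h1.1, fun x => (h1.2 x).trans (h2.2 x)⟩, h3, mono h1.2 h7⟩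
  tfae_have 2 → 3 := fun h Y _ _ θ hθ => by
    obtain ⟨φ, h1, h2, h3⟩ := h Y θ hθ
    exact ⟨φ, h1, h3⟩
  tfae_have 3 → 4 := fun h Y _ _ θ hθ => by
    obtain ⟨φ, h1, h2⟩ := h Y θ hθ
    choose g hg using h1.1
    refine ⟨g, fun x => h1.2 x (hg x), ?_⟩
    rw [← setImage_singleton]
    exact mono (fun x => singleton_subset_iff.2 (hg x)) h2
  -- A discrete space is completely metrizable and all its subsets are closed.
  tfae_have 2 → 5 := fun h Y _ _ θ hne hθ => by
    obtain ⟨φ, h1, h2, h3⟩ := h Y θ ⟨hne, hθ, fun _ => isClosed_discrete _⟩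
    exact ⟨φ, h1, h2, mk_lt_of_compactnessDegree_closure_le h3⟩
  tfae_have 5 → 6 := fun h Y _ _ θ hne hθ => by
    obtain ⟨φ, h1, h2, h3⟩ := h Y θ hne hθ
    exact ⟨φ, h1, h3⟩
  tfae_have 6 → 7 := fun h Y _ _ θ hne hθ => by
    obtain ⟨φ, h1, h2⟩ := h Y θ hne hθ
    choose g hg using h1.1
    refine ⟨g, fun x => h1.2 x (hg x), (Cardinal.mk_le_mk_of_subset ?_).trans_lt h2⟩
    exact range_subset_iff.2 fun x => mem_iUnion.2 ⟨x, hg x⟩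
  tfae_have 4 → 7 := fun h Y _ _ θ hne hθ => by
    obtain ⟨g, h1, h2⟩ := h Y θ ⟨hne, hθ, fun _ => isClosed_discrete _⟩
    exact ⟨g, h1, mk_lt_of_compactnessDegree_closure_le h2⟩
  tfae_have 7 → 8 := fun h γ hγ => exists_subcover_of_exists_selection hγ (h γ)
  tfae_have 8 → 1 := fun h => (compactnessDegree_le_iff X τ).2 fun γ hγ => by
    obtain ⟨δ, h1, h2, h3⟩ := h γ hγ
    exact ⟨δ, h2, fun V hV => ⟨V, h1 hV, subset_rfl⟩, h3⟩
  tfae_finish
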